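/- Theorem 1. Consider a discrete-time Markov decision process with finite state space $\mathcal S$, finite action space $\mathcal A$, non-empty sets $\mathcal A(s)\subseteq\mathcal A$ of admissible actions, set of admissible pairs $\mathcal K=\{(s,a): s\in\mathcal S, a\in\mathcal A(s)\}$, transition law $P(\cdot\mid s,a)$ and reward $r:\mathcal K\to\mathbb R$. Let $\mathbb U$ be the set of history-dependent randomized policies $u=(u_t)_{t\ge 0}$, where $u_t(\cdot\mid s_0,a_0,\dots,s_{t-1},a_{t-1},s_t)$ is a probability measure on $\mathcal A(s_t)$, and let $\mathbb D\subset\mathbb U$ be the set of stationary randomized policies $d(\cdot\mid s)$. For $s\in\mathcal S$ and $u\in\mathbb U$ let $\mathbb P^u_s$ be the law of the trajectory $(s_0,a_0,s_1,a_1,\dots)$ with $s_0=s$, and let $R^{s,u}_t=r(s_t,a_t)$ under $\mathbb P^u_s$. Fix $\alpha\in(0,1)$, and for a bounded random variable $\xi$ put $$\mathrm{VaR}_q(\xi)=\inf\{z\in\mathbb R:\mathbb P(\xi\le z)\ge q\},\qquad \mathrm{CVaR}_\alpha(\xi)=\frac1{1-\alpha}\int_\alpha^1\mathrm{VaR}_q(\xi)\,dq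 .$$ Define $$\mathrm{CVaR}^u_+(s)=\limsup_{T\to\infty}\frac1T\sum_{t=0}^{T-1}\mathrm{CVaR}_\alpha(R^{s,u}_t),\qquad \mathrm{CVaR}^u_-(s)=\liminf_{T\to\infty}\frac1T\sum_{t=0}^{T-1}\mathrm{CVaR}_\alpha(R^{s,u}_t).$$ Let $\hat{\mathbb U}$ be the set of all $u\in\mathbb U$ with $\mathrm{CVaR}^u_+(s)=\mathrm{CVaR}^u_-(s)$ for every $s\in\mathcal S$, and for $u\in\hat{\mathbb U}$ let $\mathrm{CVaR}^u(s)=\lim_{T\to\infty}\frac1T\sum_{t=0}^{T-1}\mathrm{CVaR}_\alpha(R^{s,u}_t)$. Assume that for every $d\in\mathbb D$ the Markov chain $(s_t)$ under $d$ is unichain (it has a single recurrent class, plus possibly transient states) and aperiodic (its recurrent states have period $1$). Then for every $d\in\mathbb D$ the limit $\pi^d(i,a)=\lim_{t\to\infty}\mathbb P^d_s(s_t=i,a_t=a)$ exists for all $s\in\mathcal S$ and $(i,a)\in\mathcal K$, does not depend on $s$, and is a probability distribution on $\mathcal K$ that is invariant under $d$. Let $R^d$ be the random variable $r(i,a)$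 with $(i,a)$ distributed according to $\pi^d$. The maximum $\max_{d\in\mathbb D}\mathrm{CVaR}_\alpha(R^d)$ is attained, and every $d^*\in\arg\max_{d\in\mathbb D}\mathrm{CVaR}_\alpha(R^d)$ belongs to $\hat{\mathbb U}$ and satisfies, for all $s\in\mathcal S$, $$\sup_{u\in\mathbb U}\mathrm{CVaR}^u_+(s)=\sup_{u\in\mathbb U}\mathrm{CVaR}^u_-(s)=\sup_{u\in\hat{\mathbb U}}\mathrm{CVaR}^u(s)=\mathrm{CVaR}^{d^*}_+(s)=\mathrm{CVaR}^{d^*}_-(s)=\mathrm{CVaR}^{d^*}(s)=\mathrm{CVaR}_\alpha(R^{d^*}).$$ -/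

import Mathlib

open MeasureTheory ProbabilityTheory Filter Topology Finset

noncomputable section

/-! ## Value-at-risk and conditional value-at-risk -/

/-- The `q`-quantile of the random variable `X` under the law `μ`:
`inf {z : q ≤ μ (X ≤ z)}`. -/
def VaR {Ω : Type*} [MeasurableSpace Ω] (μ : Measure Ω) (X : Ω → ℝ) (q : ℝ) : ℝ :=
  sInf {z : ℝ | q ≤ μ.real {ω | X ω ≤ z}}

/-- The right-tailed conditional value-at-risk at level `α`:
`(1 - α)⁻¹ ∫_α^1 VaR_q(X) dq`. -/
def CVaR {Ω : Type*} [MeasurableSpace Ω] (α : ℝ) (μ : Measure Ω) (X : Ω → ℝ) : ℝ :=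
  1 / (1 - α) * ∫ q in α..1, VaR μ X q

/-! ## Finite Markov chains -/

namespace FiniteChain

variable {S : Type*} [Fintype S] [DecidableEq S]

/-- `j` is accessible from `i`: `Q^n (i, j) > 0` for some `n ≥ 0`. -/
def Accessible (Q : Matrix S S ℝ) (i j : S) : Prop :=
  ∃ n : ℕ, 0 < (Q ^ n) i j

/-- A recurrent class of a finite chain: a non-empty set of states that is closed (no state outside
is accessible from inside) and irreducible (all its states are accessible from each other). -/
def IsRecurrentClass (Q : Matrix S S ℝ) (C : Set S) : Prop :=
  C.Nonempty ∧ ∀ i ∈ C, ∀ j, Accessible Q i j ↔ j ∈ C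

/-- Unichain: a single recurrent class (all the other states, if any, are transient). -/
def IsUnichain (Q : Matrix S S ℝ) : Prop :=
  ∃! C : Set S, IsRecurrentClass Q C

/-- Aperiodic: every recurrent state has period `1`, where the period of `i` is the greatest common
divisor of the possible return times. -/
def IsAperiodic (Q : Matrix S S ℝ) : Prop :=
  ∀ C : Set S, IsRecurrentClass Q C → ∀ i ∈ C, Nat.setGcd {n : ℕ | 1 ≤ n ∧ 0 < (Q ^ n) i i} = 1

end FiniteChain

/-! ## Markov decision processes -/

/-- A Markov decision process with state space `S` and action space `A` (used with `S`, `A`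
finite). -/
structure MDP (S A : Type*) where
  /-- the set of admissible actions at each state -/
  actions : S → Finset A
  /-- at each state some action is admissible -/
  actions_nonempty : ∀ s, (actions s).Nonempty
  /-- the transition law `P(· | s, a)`, for every admissible pair `(s, a)` -/
  P : (Σ s : S, {a : A // a ∈ actions s}) → PMF S
  /-- the reward `r(s, a)`, for every admissible pair `(s, a)` -/
  r : (Σ s : S, {a : A // a ∈ actions s}) → ℝ

namespace MDP

variable {S A : Type*} (M : MDP S A)

/-- The admissible actions at `s`. -/
abbrev Adm (s : S) : Type _ := {a : A // a ∈ M.actions s}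

/-- The set of admissible state-action pairs. -/
abbrev K : Type _ := Σ s : S, M.Adm s

/-- Every set of state-action pairs is measurable. -/
instance instMeasurableSpaceK : MeasurableSpace M.K := ⊤

/-- A history-dependent randomized policy: for every time `t` and every history
`(s₀, a₀, …, s_{t-1}, a_{t-1}, s_t)` a probability distribution on the actions admissible at
`s_t`. -/
def Policy : Type _ := (t : ℕ) → (Fin t → M.K) → (s : S) → PMF (M.Adm s)

/-- A stationary randomized policy: for every state `s` a probability distribution on the actions
admissible at `s`. -/
def StationaryPolicy : Type _ := (s : S) → PMF (M.Adm s)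

variable {M} in
/-- A stationary policy `d`, seen as the history-dependent policy `(d, d, …)`. -/
def StationaryPolicy.toPolicy (d : M.StationaryPolicy) : M.Policy := fun _ _ s => d s

/-- The law of `(s₀, a₀)` when the process starts from `s` and the policy `u` is used. -/
def initialLaw (s : S) (u : M.Policy) : PMF M.K :=
  (u 0 Fin.elim0 s).map fun a => ⟨s, a⟩

/-- The conditional law of `(s_{t+1}, a_{t+1})` given `(s₀, a₀, …, s_t, a_t)`: first `s_{t+1}` is
drawn from `P(· | s_t, a_t)`, then `a_{t+1}` from the policy. -/
def stepLaw (u : M.Policy) (t : ℕ) (h : Fin (t + 1) → M.K) : PMF M.K :=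
  (M.P (h (Fin.last t))).bind fun s' => (u (t + 1) h s').map fun a => ⟨s', a⟩

variable [Fintype S]

/-- `stepLaw` as a Markov kernel from the histories up to time `t`. -/
def stepKernel (u : M.Policy) (t : ℕ) : Kernel (Iic t → M.K) M.K :=
  Kernel.ofFunOfCountable fun x =>
    (M.stepLaw u t fun i => x ⟨i, mem_Iic.2 (Nat.lt_succ_iff.1 i.2)⟩).toMeasure

instance instIsMarkovKernelStepKernel (u : M.Policy) (t : ℕ) :
    IsMarkovKernel (M.stepKernel u t) :=
  ⟨fun _ => PMF.toMeasure.isProbabilityMeasure _⟩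

/-- The probability measure `P_s^u` on the space of trajectories
`(s₀, a₀, s₁, a₁, …)` given by the Ionescu-Tulcea theorem. -/
def trajLaw (s : S) (u : M.Policy) : Measure (ℕ → M.K) :=
  Kernel.trajMeasure (X := fun _ => M.K) (M.initialLaw s u).toMeasure (M.stepKernel u)

/-- `CVaR_α(R_t^{s,u})`, where `R_t^{s,u} = r(s_t, a_t)` is the reward at time `t`. -/
def rewardCVaR (α : ℝ) (s : S) (u : M.Policy) (t : ℕ) : ℝ :=
  CVaR α (M.trajLaw s u) fun ω => M.r (ω t)

/-- The time average `(1/T) ∑_{t < T} CVaR_α(R_t^{s,u})`. -/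
def avgCVaR (α : ℝ) (s : S) (u : M.Policy) (T : ℕ) : ℝ :=
  1 / (T : ℝ) * ∑ t ∈ range T, M.rewardCVaR α s u t

/-- The limsup long-run CVaR. -/
def limsupCVaR (α : ℝ) (s : S) (u : M.Policy) : ℝ :=
  limsup (M.avgCVaR α s u) atTop

/-- The liminf long-run CVaR. -/
def liminfCVaR (α : ℝ) (s : S) (u : M.Policy) : ℝ :=
  liminf (M.avgCVaR α s u) atTop

/-- The policies whose long-run CVaR is well defined: limsup and liminf agree at every initial
state. -/
def convergentPolicies (α : ℝ) : Set M.Policy :=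
  {u | ∀ s, M.limsupCVaR α s u = M.liminfCVaR α s u}

/-- The long-run CVaR, as a limit; meaningful for the policies in `convergentPolicies`. -/
def longRunCVaR (α : ℝ) (s : S) (u : M.Policy) : ℝ :=
  limUnder atTop (M.avgCVaR α s u)

/-- The transition matrix of the state process under the stationary policy `d`. -/
def chain (d : M.StationaryPolicy) : Matrix S S ℝ :=
  fun i j => ∑ a : M.Adm i, (d i a).toReal * (M.P ⟨i, a⟩ j).toReal

/-- `π` is the limiting (steady-state) distribution of the state-action pairs under the stationary
policy `d`: whatever the initial state, `P_s^d(s_t = i, a_t = a) → π(i, a)`. -/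
def IsSteadyState (d : M.StationaryPolicy) (π : PMF M.K) : Prop :=
  ∀ (s : S) (k : M.K),
    Tendsto (fun t : ℕ => (M.trajLaw s d.toPolicy).real {ω | ω t = k}) atTop (𝓝 (π k).toReal)

/-- `π` is invariant under `d`: it is the law of the next state-action pair when the current pair
has law `π`. -/
def IsStationaryDistribution (d : M.StationaryPolicy) (π : PMF M.K) : Prop :=
  (π.bind fun k => (M.P k).bind fun s' => (d s').map fun a => (⟨s', a⟩ : M.K)) = π

end MDP

end

/-! On a finite space the Rockafellar–Uryasev formula writes CVaR as the minimum over points `k` of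
`r k + (1 - α)⁻¹ E (r - r k)⁺` (`CVaR_eq_cvarOfWeights`). As a function of the law this is a minimum
of finitely many affine functions, hence continuous and concave.

Upper bound: by concavity, the average of the CVaRs up to time `T` is at most the CVaR of the
averaged state-action law (`avgCVaR_le_cvarOfWeights`). Whatever the policy, these averaged laws
satisfy the balance equations up to `O(1/T)` by telescoping (`tendsto_frequencies_balance`), so
their limit points lie in a compact polytope of balanced laws. Conditioning a balanced law on the
state gives a stationary policy, and the chain convergence theorem forces its steady state to be
that law (`exists_policy_of_mem_balancedFrequencies`). Hence the steady-state laws are exactly the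
balanced ones, and the maximum is attained by compactness.

Attainment: a Doeblin minorization makes the powers of each chain converge
(`FiniteChain.exists_tendsto_pow_apply`). The marginals under a stationary policy then converge, so
by continuity do their CVaRs, and the Cesàro means have the same limit. -/

theorem CVaR_comp {Ω Ω' : Type*} [MeasurableSpace Ω] [MeasurableSpace Ω']
    {μ : Measure Ω} {Y : Ω → Ω'} (hY : Measurable Y) {f : Ω' → ℝ} (hf : Measurable f) (α : ℝ) :
    CVaR α μ (fun ω => f (Y ω)) = CVaR α (μ.map Y) f := by
  have h : ∀ q, VaR μ (fun ω => f (Y ω)) q = VaR (μ.map Y) f q := fun q => by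
    unfold VaR
    congr 1
    ext z
    have : (μ.map Y).real {ω | f ω ≤ z} = μ.real {ω | f (Y ω) ≤ z} :=
      map_measureReal_apply hY (hf measurableSet_Iic)
    simp only [Set.mem_ofPred_eq, this]
  simp_rw [CVaR, h]

/-! ### Quantile functions and the Rockafellar–Uryasev formula -/

section Quantile

variable {Ω : Type*} [MeasurableSpace Ω] {μ : Measure Ω} [IsProbabilityMeasure μ] {X : Ω → ℝ}

theorem cdf_map_eq_measureReal (hX : Measurable X) (z : ℝ) :
    cdf (μ.map X) z = μ.real {ω | X ω ≤ z} := by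
  have := Measure.isProbabilityMeasure_map (μ := μ) hX.aemeasurable
  rw [cdf_eq_real, map_measureReal_apply hX measurableSet_Iic]
  rfl

/-- The Galois connection between the quantile function and the distribution function. -/
theorem VaR_le_iff (hX : Measurable X) {q : ℝ} (hq0 : 0 < q) (hq1 : q < 1) (z : ℝ) :
    VaR μ X q ≤ z ↔ q ≤ μ.real {ω | X ω ≤ z} := by
  have hset : {z : ℝ | q ≤ μ.real {ω | X ω ≤ z}} = {z : ℝ | q ≤ cdf (μ.map X) z} := by
    simp_rw [cdf_map_eq_measureReal hX]
  rw [← cdf_map_eq_measureReal hX, VaR, hset]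
  set F := cdf (μ.map X)
  have hne : {z : ℝ | q ≤ F z}.Nonempty :=
    ((tendsto_cdf_atTop (μ.map X)).eventually_const_le hq1).exists
  obtain ⟨c, hc⟩ := ((tendsto_cdf_atBot (μ.map X)).eventually_lt_const hq0).exists
  have hbdd : BddBelow {z : ℝ | q ≤ F z} := by
    refine ⟨c, fun y hy => ?_⟩
    by_contra! h
    exact absurd (hy.trans (F.mono h.le)) (not_le.2 hc)
  refine ⟨fun h => ?_, fun h => csInf_le hbdd h⟩
  refine le_trans ?_ (F.mono h)
  -- Right-continuity of the distribution function puts the infimum itself in the set.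
  have hr : Tendsto F (𝓝[>] (sInf {z : ℝ | q ≤ F z})) (𝓝 (F (sInf {z : ℝ | q ≤ F z}))) :=
    ((F.right_continuous _).mono Set.Ioi_subset_Ici_self)
  refine ge_of_tendsto hr (eventually_nhdsWithin_of_forall fun y hy => ?_)
  obtain ⟨w, hw, hwy⟩ := exists_lt_of_csInf_lt hne (Set.mem_Ioi.1 hy)
  exact le_trans hw (F.mono hwy.le)

theorem monotoneOn_VaR (hX : Measurable X) : MonotoneOn (VaR μ X) (Set.Ioo 0 1) := by
  intro p hp q hq hpq
  rw [VaR_le_iff hX hp.1 hp.2]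
  exact hpq.trans ((VaR_le_iff hX hq.1 hq.2 _).1 le_rfl)

theorem aemeasurable_VaR (hX : Measurable X) :
    AEMeasurable (VaR μ X) (volume.restrict (Set.Ioo 0 1)) :=
  aemeasurable_restrict_of_monotoneOn measurableSet_Ioo (monotoneOn_VaR hX)

/-- The quantile function of a uniform variable has the law of `X`. -/
theorem map_VaR (hX : Measurable X) :
    (volume.restrict (Set.Ioo (0 : ℝ) 1)).map (VaR μ X) = μ.map X := by
  have h1 : IsProbabilityMeasure (volume.restrict (Set.Ioo (0 : ℝ) 1)) := ⟨by simp⟩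
  have := Measure.isProbabilityMeasure_map (aemeasurable_VaR (μ := μ) hX)
  have := Measure.isProbabilityMeasure_map (μ := μ) hX.aemeasurable
  refine Measure.ext_of_Iic _ _ fun z => ?_
  rw [Measure.map_apply_of_aemeasurable (aemeasurable_VaR hX) measurableSet_Iic,
    Measure.map_apply hX measurableSet_Iic]
  have hp : μ.real {ω | X ω ≤ z} ≤ 1 := measureReal_le_one
  -- Only almost everywhere: the right side contains `q = 1` when `X ≤ z` has full mass.
  have : ((VaR μ X ⁻¹' Set.Iic z) ∩ Set.Ioo 0 1 : Set ℝ)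
      =ᵐ[volume] Set.Ioc 0 (μ.real {ω | X ω ≤ z}) := by
    have h2 : (VaR μ X ⁻¹' Set.Iic z) ∩ Set.Ioo 0 1
        = Set.Ioc 0 (μ.real {ω | X ω ≤ z}) ∩ Set.Iio 1 := by
      ext q
      simp only [Set.mem_inter_iff, Set.mem_preimage, Set.mem_Iic, Set.mem_Ioo, Set.mem_Ioc,
        Set.mem_Iio]
      constructor
      · rintro ⟨h, h0, h1⟩
        exact ⟨⟨h0, (VaR_le_iff hX h0 h1 z).1 h⟩, h1⟩
      · rintro ⟨⟨h0, h⟩, h1⟩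
        exact ⟨(VaR_le_iff hX h0 h1 z).2 h, h0, h1⟩
    rw [h2]
    refine ((ae_eq_refl (Set.Ioc 0 (μ.real {ω | X ω ≤ z}))).inter Iio_ae_eq_Iic).trans ?_
    rw [Set.inter_eq_left.2 fun q hq => hq.2.trans hp]
    exact ae_eq_refl _
  rw [Measure.restrict_apply₀' measurableSet_Ioo.nullMeasurableSet, measure_congr this,
    Real.volume_Ioc, sub_zero, ofReal_measureReal]
  rfl

theorem integral_comp_VaR (hX : Measurable X) {f : ℝ → ℝ} (hf : Measurable f) :
    ∫ q in Set.Ioo (0 : ℝ) 1, f (VaR μ X q) = ∫ ω, f (X ω) ∂μ := by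
  rw [← integral_map (aemeasurable_VaR hX) hf.aestronglyMeasurable, map_VaR hX,
    integral_map hX.aemeasurable hf.aestronglyMeasurable]

theorem integrableOn_comp_VaR (hX : Measurable X) {f : ℝ → ℝ} (hf : Measurable f)
    (hi : Integrable (fun ω => f (X ω)) μ) :
    IntegrableOn (fun q => f (VaR μ X q)) (Set.Ioo (0 : ℝ) 1) := by
  refine (integrable_map_measure (g := f) hf.aestronglyMeasurable (aemeasurable_VaR hX)).1 ?_
  rw [map_VaR hX]
  exact (integrable_map_measure hf.aestronglyMeasurable hX.aemeasurable).2 hi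

theorem CVaR_eq_add_setIntegral (hX : Measurable X) (hi : Integrable X μ) {α : ℝ} (hα0 : 0 < α)
    (hα1 : α < 1) (b : ℝ) :
    CVaR α μ X = b + 1 / (1 - α) * ∫ q in Set.Ioo α 1, (VaR μ X q - b) := by
  have hint : IntegrableOn (VaR μ X) (Set.Ioo α 1) :=
    (integrableOn_comp_VaR hX measurable_id hi).mono_set (Set.Ioo_subset_Ioo_left hα0.le)
  rw [CVaR, intervalIntegral.integral_of_le hα1.le, integral_Ioc_eq_integral_Ioo,
    integral_sub hint (integrable_const _), setIntegral_const, Real.volume_real_Ioo_of_le hα1.le,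
    smul_eq_mul]
  have : 1 - α ≠ 0 := by linarith
  field_simp
  ring

/-- Replacing `VaR - b` by its positive part and enlarging `(α, 1)` to `(0, 1)` can only increase
the integral, which `map_VaR` then turns into an expectation. -/
theorem CVaR_le (hX : Measurable X) (hi : Integrable X μ) {α : ℝ} (hα0 : 0 < α)
    (hα1 : α < 1) (b : ℝ) :
    CVaR α μ X ≤ b + 1 / (1 - α) * ∫ ω, max (X ω - b) 0 ∂μ := by
  have hm : Measurable fun x : ℝ => max (x - b) 0 := by fun_prop
  have h1 : IntegrableOn (fun q => max (VaR μ X q - b) 0) (Set.Ioo (0 : ℝ) 1) :=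
    integrableOn_comp_VaR hX hm ((hi.sub (integrable_const b)).pos_part)
  have h2 : IntegrableOn (fun q => VaR μ X q - b) (Set.Ioo (0 : ℝ) 1) :=
    integrableOn_comp_VaR (f := fun x => x - b) hX (by fun_prop) (hi.sub (integrable_const b))
  have hsub : Set.Ioo α 1 ⊆ Set.Ioo (0 : ℝ) 1 := Set.Ioo_subset_Ioo_left hα0.le
  rw [CVaR_eq_add_setIntegral hX hi hα0 hα1 b, ← integral_comp_VaR hX hm]
  have : 0 ≤ 1 / (1 - α) := by rw [one_div_nonneg]; linarith
  gcongr
  calc ∫ q in Set.Ioo α 1, (VaR μ X q - b)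
      ≤ ∫ q in Set.Ioo α 1, max (VaR μ X q - b) 0 :=
        integral_mono (h2.mono_set hsub) (h1.mono_set hsub) fun q => le_max_left _ _
    _ ≤ _ := setIntegral_mono_set h1 (ae_of_all _ fun q => le_max_right _ _)
        hsub.eventuallyLE

/-- The Rockafellar–Uryasev formula is attained at the value-at-risk. -/
theorem CVaR_eq (hX : Measurable X) (hi : Integrable X μ) {α : ℝ} (hα0 : 0 < α)
    (hα1 : α < 1) :
    CVaR α μ X = VaR μ X α + 1 / (1 - α) * ∫ ω, max (X ω - VaR μ X α) 0 ∂μ := by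
  set b := VaR μ X α with hb
  have hm : Measurable fun x : ℝ => max (x - b) 0 := by fun_prop
  rw [CVaR_eq_add_setIntegral hX hi hα0 hα1 b, ← integral_comp_VaR hX hm]
  congr 2
  have hsub : Set.Ioo α 1 ⊆ Set.Ioo (0 : ℝ) 1 := Set.Ioo_subset_Ioo_left hα0.le
  -- Both inequalities of `CVaR_le` are equalities at `b = VaR μ X α`: by monotonicity `VaR - b` is
  -- nonnegative above `α` and nonpositive below.
  rw [setIntegral_eq_of_subset_of_forall_sdiff_eq_zero (s := Set.Ioo α 1) measurableSet_Ioo hsub]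
  · refine setIntegral_congr_fun measurableSet_Ioo fun q hq => ?_
    have := monotoneOn_VaR (μ := μ) hX ⟨hα0, hα1⟩ (hsub hq) hq.1.le
    rw [max_eq_left (by linarith)]
  · rintro q ⟨hq, hq'⟩
    have hqα : q ≤ α := by
      by_contra! h
      exact hq' ⟨h, hq.2⟩
    have := monotoneOn_VaR (μ := μ) hX hq ⟨hα0, hα1⟩ hqα
    exact max_eq_right (by linarith)

end Quantile

/-! ### CVaR as a concave function of the law on a finite space -/

section FiniteSpace

variable {K : Type*} [Fintype K] [Nonempty K]

/-- The conditional value-at-risk of `r` on a finite space, as a function of the weights of the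
points, in the form of Rockafellar and Uryasev. -/
noncomputable def cvarOfWeights (α : ℝ) (r w : K → ℝ) : ℝ :=
  univ.inf' univ_nonempty fun k => r k + 1 / (1 - α) * ∑ l, w l * max (r l - r k) 0

theorem continuous_cvarOfWeights (α : ℝ) (r : K → ℝ) : Continuous (cvarOfWeights α r) := by
  unfold cvarOfWeights
  exact Continuous.finset_inf'_apply _ fun k _ => by fun_prop

/-- Jensen's inequality for a minimum of functions affine in `w`: each affine piece commutes with
averaging. -/
theorem average_cvarOfWeights_le (α : ℝ) (r : K → ℝ) (w : ℕ → K → ℝ) {T : ℕ} (hT : T ≠ 0) :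
    1 / (T : ℝ) * ∑ t ∈ range T, cvarOfWeights α r (w t) ≤
      cvarOfWeights α r (fun k => 1 / (T : ℝ) * ∑ t ∈ range T, w t k) := by
  have hT' : (T : ℝ) ≠ 0 := by exact_mod_cast hT
  refine le_inf' _ _ fun k _ => ?_
  calc 1 / (T : ℝ) * ∑ t ∈ range T, cvarOfWeights α r (w t)
      ≤ 1 / (T : ℝ) * ∑ t ∈ range T, (r k + 1 / (1 - α) * ∑ l, w t l * max (r l - r k) 0) := by
        gcongr with t
        exact inf'_le _ (mem_univ k)
    _ = _ := by
        simp_rw [sum_add_distrib, ← mul_sum, mul_assoc, sum_mul, sum_const, card_range,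
          nsmul_eq_mul, ← mul_sum]
        rw [sum_comm]
        field_simp

theorem CVaR_eq_cvarOfWeights [MeasurableSpace K] [MeasurableSingletonClass K] (μ : Measure K)
    [IsProbabilityMeasure μ] {α : ℝ} (hα0 : 0 < α) (hα1 : α < 1) (r : K → ℝ) :
    CVaR α μ r = cvarOfWeights α r fun k => μ.real {k} := by
  have hr : Measurable r := measurable_of_finite r
  have hi : Integrable r μ := Integrable.of_finite
  have key : ∀ b : ℝ, ∫ x, max (r x - b) 0 ∂μ = ∑ l, μ.real {l} * max (r l - b) 0 := fun b => by
    rw [integral_fintype Integrable.of_finite]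
    rfl
  refine le_antisymm (le_inf' _ _ fun k _ => ?_) ?_
  · rw [← key]
    exact CVaR_le hr hi hα0 hα1 (r k)
  · have hb := (VaR_le_iff (μ := μ) hr hα0 hα1 _).1 le_rfl
    set b := VaR μ r α with hbdef
    -- The quantile `b` is a value of `r`: the largest value not exceeding `b` has the same
    -- distribution function there. So a minimum over points of `K` suffices.
    have hne : (univ.filter fun k => r k ≤ b).Nonempty := by
      by_contra h
      rw [not_nonempty_iff_eq_empty, filter_eq_empty_iff] at h
      have : {k | r k ≤ b} = ∅ := by
        ext k
        simpa using h (mem_univ k)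
      rw [this, measureReal_empty] at hb
      linarith
    obtain ⟨k, hk, hmax⟩ := exists_max_image _ r hne
    have hkb : r k = b := by
      refine le_antisymm (mem_filter.1 hk).2 ?_
      rw [hbdef, VaR_le_iff hr hα0 hα1]
      refine hb.trans (measureReal_mono fun l hl => ?_)
      exact hmax l (mem_filter.2 ⟨mem_univ l, hl⟩)
    rw [CVaR_eq hr hi hα0 hα1, key, ← hbdef, ← hkb]
    exact inf'_le _ (mem_univ k)

end FiniteSpace

/-! ### Convergence of finite aperiodic unichains -/

namespace FiniteChain

variable {S : Type*} [Fintype S] [DecidableEq S] {Q : Matrix S S ℝ}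

theorem pow_nonneg_apply (hQ : Q ∈ Matrix.rowStochastic ℝ S) (n : ℕ) (i j : S) :
    0 ≤ (Q ^ n) i j :=
  (pow_mem hQ n).1 i j

theorem sum_pow_apply (hQ : Q ∈ Matrix.rowStochastic ℝ S) (n : ℕ) (i : S) :
    ∑ j, (Q ^ n) i j = 1 :=
  Matrix.sum_row_of_mem_rowStochastic (pow_mem hQ n) i

theorem pow_add_apply_pos (hQ : Q ∈ Matrix.rowStochastic ℝ S) {m n : ℕ} {i j k : S}
    (hm : 0 < (Q ^ m) i j) (hn : 0 < (Q ^ n) j k) : 0 < (Q ^ (m + n)) i k := by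
  rw [pow_add, Matrix.mul_apply]
  exact sum_pos' (fun l _ => mul_nonneg (pow_nonneg_apply hQ m i l) (pow_nonneg_apply hQ n l k))
    ⟨j, mem_univ j, mul_pos hm hn⟩

theorem Accessible.refl (Q : Matrix S S ℝ) (i : S) : Accessible Q i i :=
  ⟨0, by simp⟩

theorem Accessible.trans (hQ : Q ∈ Matrix.rowStochastic ℝ S) {i j k : S}
    (hij : Accessible Q i j) (hjk : Accessible Q j k) : Accessible Q i k := by
  obtain ⟨m, hm⟩ := hij
  obtain ⟨n, hn⟩ := hjk
  exact ⟨m + n, pow_add_apply_pos hQ hm hn⟩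

/-- Every state of a finite chain leads to a recurrent class. -/
theorem exists_isRecurrentClass_accessible (hQ : Q ∈ Matrix.rowStochastic ℝ S) (i : S) :
    ∃ C, IsRecurrentClass Q C ∧ ∀ j ∈ C, Accessible Q i j := by
  classical
  let R : S → Finset S := fun i => univ.filter fun j => Accessible Q i j
  have hR : ∀ i j, j ∈ R i ↔ Accessible Q i j := fun i j => by simp [R]
  have hmono : ∀ i j, Accessible Q i j → R j ⊆ R i := fun i j hij k hk =>
    (hR _ _).2 (hij.trans hQ ((hR _ _).1 hk))
  -- Take a smallest reachable set: any state in it reaches a subset, which by minimality is the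
  -- whole set.
  obtain ⟨j, hj, hmin⟩ :=
    exists_min_image (R i) (fun j => #(R j)) ⟨i, (hR _ _).2 (Accessible.refl Q i)⟩
  refine ⟨R j, ⟨⟨j, (hR _ _).2 (Accessible.refl Q j)⟩, fun k hk l => ?_⟩, fun k hk => ?_⟩
  · have hjk := (hR _ _).1 hk
    have := eq_of_subset_of_card_le (hmono j k hjk) (hmin k (hmono i j ((hR _ _).1 hj) hk))
    rw [← hR, this, mem_coe]
  · exact ((hR _ _).1 hj).trans hQ ((hR _ _).1 hk)

/-- At a state of period `1` all large times are return times. -/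
theorem exists_forall_pow_apply_self_pos (hQ : Q ∈ Matrix.rowStochastic ℝ S) {i : S}
    (hi : Nat.setGcd {n : ℕ | 1 ≤ n ∧ 0 < (Q ^ n) i i} = 1) :
    ∃ N, ∀ n ≥ N, 0 < (Q ^ n) i i := by
  obtain ⟨N, hN⟩ := Nat.exists_mem_closure_of_ge {n : ℕ | 1 ≤ n ∧ 0 < (Q ^ n) i i}
  refine ⟨N, fun n hn => ?_⟩
  have hmem := hN n hn (by rw [hi]; exact one_dvd n)
  exact AddSubmonoid.closure_induction (motive := fun n _ => 0 < (Q ^ n) i i) (fun x hx => hx.2)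
    (by simp) (fun x y _ _ hx hy => pow_add_apply_pos hQ hx hy) hmem

/-- The Doeblin condition: some state is reached from all states at some common time. -/
theorem exists_forall_pow_apply_pos (hQ : Q ∈ Matrix.rowStochastic ℝ S) (hu : IsUnichain Q)
    (ha : IsAperiodic Q) : ∃ (N : ℕ) (j : S), ∀ i, 0 < (Q ^ N) i j := by
  obtain ⟨C, hC, huniq⟩ := hu
  obtain ⟨j, hj⟩ := hC.1
  obtain ⟨N, hN⟩ := exists_forall_pow_apply_self_pos hQ (ha C hC j hj)
  have hacc : ∀ i, ∃ n, 0 < (Q ^ n) i j := fun i => by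
    obtain ⟨C', hC', h⟩ := exists_isRecurrentClass_accessible hQ i
    rw [huniq C' hC'] at h
    exact h j hj
  choose n hn using hacc
  -- A time exceeding every `n i` by at least `N`: after reaching `j`, the leftover time is a return
  -- time of `j`.
  refine ⟨N + ∑ i, n i, j, fun i => ?_⟩
  have hle : n i ≤ ∑ i, n i := single_le_sum (fun _ _ => Nat.zero_le _) (mem_univ i)
  have : N + ∑ i, n i = n i + (N + ∑ i, n i - n i) := by omega
  rw [this]
  exact pow_add_apply_pos hQ (hn i) (hN _ (by omega))

/-- Averaging with a minorized stochastic matrix contracts the range of a vector. -/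
theorem mulVec_mem_Icc {P : Matrix S S ℝ} (hP : P ∈ Matrix.rowStochastic ℝ S) {δ : ℝ} {j₀ : S}
    (hδ : ∀ i, δ ≤ P i j₀) {v : S → ℝ} {m c : ℝ} (hv : ∀ i, v i ∈ Set.Icc m (m + c)) (i : S) :
    (P.mulVec v) i ∈ Set.Icc (δ * v j₀ + (1 - δ) * m) (δ * v j₀ + (1 - δ) * m + (1 - δ) * c) := by
  -- Split off the mass `δ` at `j₀` common to all rows; only the remaining mass `1 - δ` depends on
  -- `i`.
  set a : S → ℝ := fun k => P i k - if k = j₀ then δ else 0 with ha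
  have ha0 : ∀ k, 0 ≤ a k := fun k => by
    simp only [ha]
    split_ifs with h
    · rw [h]; linarith [hδ i]
    · linarith [hP.1 i k]
  have hasum : ∑ k, a k = 1 - δ := by
    simp [ha, sum_sub_distrib, Matrix.sum_row_of_mem_rowStochastic hP i]
  have hPv : (P.mulVec v) i = δ * v j₀ + ∑ k, a k * v k := by
    simp [ha, sub_mul, sum_sub_distrib, Matrix.mulVec, dotProduct]
  have h1 : (1 - δ) * m ≤ ∑ k, a k * v k := by
    rw [← hasum, sum_mul]
    exact sum_le_sum fun k _ => mul_le_mul_of_nonneg_left (hv k).1 (ha0 k)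
  have h2 : ∑ k, a k * v k ≤ (1 - δ) * (m + c) := by
    rw [← hasum, sum_mul]
    exact sum_le_sum fun k _ => mul_le_mul_of_nonneg_left (hv k).2 (ha0 k)
  rw [hPv]
  constructor <;> linarith

/-- The case `δ = 0`: it keeps a column of `Q ^ n` within its band at all later times. -/
theorem mulVec_mem_Icc_of_forall_mem {P : Matrix S S ℝ} (hP : P ∈ Matrix.rowStochastic ℝ S)
    {v : S → ℝ} {m c : ℝ} (hv : ∀ i, v i ∈ Set.Icc m (m + c)) (i : S) :
    (P.mulVec v) i ∈ Set.Icc m (m + c) := by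
  simpa using mulVec_mem_Icc hP (δ := 0) (j₀ := i) (fun k => hP.1 k i) hv i

/-- The convergence theorem for finite aperiodic unichains. -/
theorem exists_tendsto_pow_apply (hQ : Q ∈ Matrix.rowStochastic ℝ S) (hu : IsUnichain Q)
    (ha : IsAperiodic Q) :
    ∃ ν : S → ℝ, ∀ i j, Tendsto (fun n => (Q ^ n) i j) atTop (𝓝 (ν j)) := by
  obtain ⟨N, j₀, hpos⟩ := exists_forall_pow_apply_pos hQ hu ha
  obtain ⟨i₁, -, hi₁⟩ := exists_min_image univ (fun i => (Q ^ N) i j₀) ⟨j₀, mem_univ j₀⟩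
  set δ := (Q ^ N) i₁ j₀ with hδ
  have hδ0 : 0 < δ := hpos i₁
  have hmul : ∀ p n j i, (Q ^ (p + n)) i j = ((Q ^ p).mulVec fun k => (Q ^ n) k j) i :=
    fun p n j i => by rw [pow_add, Matrix.mul_apply]; rfl
  -- From time `N * l` on, all entries of column `j` share a band of width `(1 - δ) ^ l`. This
  -- yields both the Cauchy property and independence of the starting state.
  have band : ∀ j l, ∃ m, ∀ p ≥ N * l, ∀ i, (Q ^ p) i j ∈ Set.Icc m (m + (1 - δ) ^ l) := by
    intro j l
    suffices h : ∃ m, ∀ i, (Q ^ (N * l)) i j ∈ Set.Icc m (m + (1 - δ) ^ l) by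
      obtain ⟨m, hm⟩ := h
      refine ⟨m, fun p hp i => ?_⟩
      rw [← Nat.sub_add_cancel hp, hmul]
      exact mulVec_mem_Icc_of_forall_mem (pow_mem hQ _) hm i
    induction l with
    | zero =>
      refine ⟨0, fun i => ⟨pow_nonneg_apply hQ _ i j, ?_⟩⟩
      simp only [pow_zero, zero_add]
      rw [← sum_pow_apply hQ (N * 0) i]
      exact single_le_sum (fun k _ => pow_nonneg_apply hQ _ i k) (mem_univ j)
    | succ l ih =>
      obtain ⟨m, hm⟩ := ih
      refine ⟨δ * (Q ^ (N * l)) j₀ j + (1 - δ) * m, fun i => ?_⟩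
      rw [Nat.mul_succ, Nat.add_comm (N * l), hmul, pow_succ']
      exact mulVec_mem_Icc (pow_mem hQ N) (fun k => hi₁ k (mem_univ k)) hm i
  have hsmall : ∀ ε > 0, ∃ l : ℕ, (1 - δ) ^ l < ε := fun ε hε =>
    exists_pow_lt_of_lt_one hε (by linarith)
  have hlim : ∀ j, ∃ ν : ℝ, Tendsto (fun n => (Q ^ n) j₀ j) atTop (𝓝 ν) := fun j => by
    refine cauchySeq_tendsto_of_complete (Metric.cauchySeq_iff'.2 fun ε hε => ?_)
    obtain ⟨l, hl⟩ := hsmall ε hε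
    obtain ⟨m, hm⟩ := band j l
    refine ⟨N * l, fun p hp => ?_⟩
    have h1 := hm p hp j₀
    have h2 := hm (N * l) le_rfl j₀
    rw [Real.dist_eq, abs_lt]
    constructor <;> linarith [h1.1, h1.2, h2.1, h2.2]
  choose ν hν using hlim
  refine ⟨ν, fun i j => ?_⟩
  have hdiff : Tendsto (fun n => (Q ^ n) i j - (Q ^ n) j₀ j) atTop (𝓝 0) := by
    refine Metric.tendsto_atTop.2 fun ε hε => ?_
    obtain ⟨l, hl⟩ := hsmall ε hε
    obtain ⟨m, hm⟩ := band j l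
    refine ⟨N * l, fun p hp => ?_⟩
    have h1 := hm p hp j₀
    have h2 := hm p hp i
    rw [Real.dist_eq, sub_zero, abs_lt]
    constructor <;> linarith [h1.1, h1.2, h2.1, h2.2]
  simpa using hdiff.add (hν j)

end FiniteChain

theorem PMF.sum_toReal {β : Type*} [Fintype β] (p : PMF β) : ∑ b, (p b).toReal = 1 := by
  rw [← ENNReal.toReal_sum fun b _ => p.apply_ne_top b,
    ← tsum_fintype (L := .unconditional _), p.tsum_coe,
    ENNReal.toReal_one]

/-! ### One-step evolution of the state-action marginals -/

namespace MDP

variable {S A : Type*} (M : MDP S A)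

theorem stepLaw_apply (u : M.Policy) (t : ℕ) (h : Fin (t + 1) → M.K) (j : S) (a : M.Adm j) :
    M.stepLaw u t h ⟨j, a⟩ = M.P (h (Fin.last t)) j * u (t + 1) h j a := by
  classical
  rw [stepLaw, PMF.bind_apply, tsum_eq_single j, PMF.map_apply, tsum_eq_single a]
  · simp
  · intro b hb
    rw [if_neg]
    intro hab
    exact hb (eq_of_heq (Sigma.mk.inj hab).2).symm
  · intro i hi
    rw [PMF.map_apply, ENNReal.tsum_eq_zero.2, mul_zero]
    intro b
    rw [if_neg]
    intro hab
    exact hi (Sigma.mk.inj hab).1.symm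

variable [Fintype S] (s : S) (u : M.Policy)

instance : IsProbabilityMeasure (M.initialLaw s u).toMeasure :=
  PMF.toMeasure.isProbabilityMeasure _

instance : IsProbabilityMeasure (M.trajLaw s u) := by
  unfold trajLaw
  infer_instance

/-- The probability of the state-action pair `k` at time `t`. -/
noncomputable def marginal (t : ℕ) (k : M.K) : ℝ :=
  (M.trajLaw s u).real {ω | ω t = k}

theorem marginal_eq_map (t : ℕ) (k : M.K) :
    M.marginal s u t k = ((M.trajLaw s u).map fun ω => ω t).real {k} := by
  rw [map_measureReal_apply (measurable_pi_apply t) (measurableSet_singleton k)]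
  rfl

theorem integral_comp_eval (t : ℕ) (f : M.K → ℝ) :
    ∫ ω, f (ω t) ∂M.trajLaw s u = ∑ k, M.marginal s u t k * f k := by
  have : IsProbabilityMeasure ((M.trajLaw s u).map fun ω => ω t) :=
    Measure.isProbabilityMeasure_map (measurable_pi_apply t).aemeasurable
  rw [← integral_map (φ := fun ω : ℕ → M.K => ω t) (measurable_pi_apply t).aemeasurable
    (measurable_of_finite f).aestronglyMeasurable, integral_fintype Integrable.of_finite]
  simp_rw [marginal_eq_map, smul_eq_mul]

theorem marginal_nonneg (t : ℕ) (k : M.K) : 0 ≤ M.marginal s u t k :=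
  measureReal_nonneg

theorem sum_marginal (t : ℕ) : ∑ k, M.marginal s u t k = 1 := by
  simpa using (M.integral_comp_eval s u t fun _ => 1).symm

theorem measurable_comp_history (t : ℕ) (f : (Fin (t + 1) → M.K) → ℝ) :
    Measurable fun ω : ℕ → M.K => f fun i => ω i :=
  (measurable_of_countable f).comp (measurable_pi_lambda _ fun i => measurable_pi_apply (i : ℕ))

theorem integrable_stepLaw (t : ℕ) (k : M.K) :
    Integrable (fun ω => (M.stepLaw u t (fun i => ω i) k).toReal) (M.trajLaw s u) := by
  refine Integrable.of_bound
    (M.measurable_comp_history t fun h => (M.stepLaw u t h k).toReal).aestronglyMeasurable 1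
    (ae_of_all _ fun ω => ?_)
  rw [Real.norm_of_nonneg ENNReal.toReal_nonneg]
  exact ENNReal.toReal_le_of_le_ofReal zero_le_one (by simpa using PMF.coe_le_one _ _)

theorem marginal_succ (t : ℕ) (k : M.K) :
    M.marginal s u (t + 1) k =
      ∫ ω, (M.stepLaw u t (fun i => ω i) k).toReal ∂M.trajLaw s u := by
  have h := Kernel.map_frestrictLe_trajMeasure_compProd_eq_map_trajMeasure
    (X := fun _ => M.K) (μ₀ := (M.initialLaw s u).toMeasure) (κ := M.stepKernel u) (a := t)
  -- The joint law of the history and the next pair is a composition-product; evaluating on `univ ×ˢ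
  -- {k}` integrates out the history.
  have h2 := congrArg (fun ν => (ν (Set.univ ×ˢ {k})).toReal) h
  have hm : Measurable (Preorder.frestrictLe (π := fun _ : ℕ => M.K) t) :=
    Preorder.measurable_frestrictLe t
  rw [Measure.map_apply (by fun_prop) (MeasurableSet.univ.prod (measurableSet_singleton k)),
    Measure.compProd_apply_prod MeasurableSet.univ (measurableSet_singleton k)] at h2
  rw [setLIntegral_univ, lintegral_map (Kernel.measurable_coe _ (measurableSet_singleton k)) hm]
    at h2
  have hmeas := (M.measurable_comp_history t fun h => (M.stepLaw u t h k).toReal)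
  rw [integral_eq_lintegral_of_nonneg_ae (ae_of_all _ fun _ => ENNReal.toReal_nonneg)
    hmeas.aestronglyMeasurable]
  refine Eq.trans ?_ (h2.symm.trans ?_)
  · rw [marginal, measureReal_def]
    congr 2
    ext ω
    simp
  · congr 1
    refine lintegral_congr fun ω => ?_
    rw [ENNReal.ofReal_toReal (PMF.apply_ne_top _ _), 
      ← PMF.toMeasure_apply_singleton _ _ (measurableSet_singleton k)]
    rfl

/-- Summing over actions eliminates the policy, so this flow equation holds even for
history-dependent `u`. -/
theorem sum_marginal_succ (t : ℕ) (j : S) :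
    ∑ a, M.marginal s u (t + 1) ⟨j, a⟩ = ∑ k, M.marginal s u t k * (M.P k j).toReal := by
  simp_rw [marginal_succ]
  rw [← integral_finsetSum _ fun a _ => M.integrable_stepLaw s u t _, ← integral_comp_eval]
  congr 1
  ext ω
  simp_rw [stepLaw_apply, ENNReal.toReal_mul]
  rw [← mul_sum, PMF.sum_toReal, mul_one]
  rfl

theorem marginal_toPolicy_succ (d : M.StationaryPolicy) (t : ℕ) (j : S) (a : M.Adm j) :
    M.marginal s d.toPolicy (t + 1) ⟨j, a⟩ =
      (∑ k, M.marginal s d.toPolicy t k * (M.P k j).toReal) * (d j a).toReal := by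
  rw [marginal_succ, ← integral_comp_eval, ← integral_mul_const]
  congr 1
  ext ω
  rw [stepLaw_apply, ENNReal.toReal_mul]
  rfl

theorem rewardCVaR_eq {α : ℝ} (hα0 : 0 < α) (hα1 : α < 1) [Nonempty M.K] (t : ℕ) :
    M.rewardCVaR α s u t = cvarOfWeights α M.r (M.marginal s u t) := by
  have : IsProbabilityMeasure ((M.trajLaw s u).map fun ω => ω t) :=
    Measure.isProbabilityMeasure_map (measurable_pi_apply t).aemeasurable
  rw [rewardCVaR, CVaR_comp (measurable_pi_apply t) (measurable_of_finite M.r),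
    CVaR_eq_cvarOfWeights _ hα0 hα1]
  simp_rw [← marginal_eq_map]

end MDP

theorem FiniteChain.tendsto_vecMul_pow {S : Type*} [Fintype S] [DecidableEq S]
    {Q : Matrix S S ℝ} {ν : S → ℝ} (h : ∀ i j, Tendsto (fun n => (Q ^ n) i j) atTop (𝓝 (ν j)))
    {p : S → ℝ} (hp : ∑ i, p i = 1) (j : S) :
    Tendsto (fun n => (Matrix.vecMul p (Q ^ n)) j) atTop (𝓝 (ν j)) := by
  have := tendsto_finsetSum univ fun i (_ : i ∈ univ) => (h i j).const_mul (p i)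
  rwa [← sum_mul, hp, one_mul] at this

/-! ### Steady states and balanced state-action frequencies -/

namespace MDP

variable {S A : Type*} (M : MDP S A)

/-- The stationary policy that chooses actions with the conditional frequencies. -/
theorem exists_policy_of_nonneg {w : M.K → ℝ} (hw : ∀ k, 0 ≤ w k) :
    ∃ d : M.StationaryPolicy, ∀ i a, w ⟨i, a⟩ = (∑ b, w ⟨i, b⟩) * (d i a).toReal := by
  suffices h : ∀ i, ∃ q : PMF (M.Adm i), ∀ a, w ⟨i, a⟩ = (∑ b, w ⟨i, b⟩) * (q a).toReal by
    choose d hd using h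
    exact ⟨d, hd⟩
  intro i
  by_cases h0 : ∑ b, w ⟨i, b⟩ = 0
  -- At a state of zero weight both sides vanish, so any action will do.
  · obtain ⟨a, ha⟩ := M.actions_nonempty i
    refine ⟨PMF.pure ⟨a, ha⟩, fun b => ?_⟩
    rw [h0, zero_mul]
    exact (sum_eq_zero_iff_of_nonneg fun b _ => hw ⟨i, b⟩).1 h0 b (mem_univ b)
  · have hpos : 0 ≤ ∑ b, w ⟨i, b⟩ := sum_nonneg fun b _ => hw ⟨i, b⟩
    have hdiv : ∀ a, 0 ≤ w ⟨i, a⟩ / ∑ b, w ⟨i, b⟩ := fun a => div_nonneg (hw _) hpos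
    refine ⟨PMF.ofFintype (fun a => ENNReal.ofReal (w ⟨i, a⟩ / ∑ b, w ⟨i, b⟩)) ?_, fun a => ?_⟩
    · rw [← ENNReal.ofReal_sum_of_nonneg fun a _ => hdiv a, ← sum_div, div_self h0,
        ENNReal.ofReal_one]
    · rw [PMF.ofFintype_apply, ENNReal.toReal_ofReal (hdiv a), mul_div_cancel₀ _ h0]

variable [Fintype S]

theorem sum_pair (f : M.K → ℝ) : ∑ k, f k = ∑ i, ∑ a, f ⟨i, a⟩ :=
  Fintype.sum_sigma f

theorem chain_mem_rowStochastic [DecidableEq S] (d : M.StationaryPolicy) :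
    M.chain d ∈ Matrix.rowStochastic ℝ S := by
  refine Matrix.mem_rowStochastic_iff_sum.2 ⟨fun i j => ?_, fun i => ?_⟩
  · exact sum_nonneg fun a _ => mul_nonneg ENNReal.toReal_nonneg ENNReal.toReal_nonneg
  · simp_rw [chain]
    rw [sum_comm]
    simp_rw [← mul_sum, PMF.sum_toReal, mul_one]
    exact PMF.sum_toReal _

theorem sum_mul_transition_eq_vecMul {d : M.StationaryPolicy} {w : M.K → ℝ} {p : S → ℝ}
    (h : ∀ i a, w ⟨i, a⟩ = p i * (d i a).toReal) (j : S) :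
    ∑ k, w k * (M.P k j).toReal = Matrix.vecMul p (M.chain d) j := by
  simp_rw [sum_pair, h, Matrix.vecMul, dotProduct, chain, mul_sum, mul_assoc]

theorem tendsto_marginal [DecidableEq S] {d : M.StationaryPolicy} {ν : S → ℝ}
    (hν : ∀ i j, Tendsto (fun n => (M.chain d ^ n) i j) atTop (𝓝 (ν j))) (s j : S)
    (a : M.Adm j) :
    Tendsto (fun t => M.marginal s d.toPolicy t ⟨j, a⟩) atTop (𝓝 (ν j * (d j a).toReal)) := by
  -- `p t` is the law of the state at time `t + 1`, whence the index shift below.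
  set p : ℕ → S → ℝ := fun t j => ∑ k, M.marginal s d.toPolicy t k * (M.P k j).toReal with hp
  have hsucc : ∀ t j a, M.marginal s d.toPolicy (t + 1) ⟨j, a⟩ = p t j * (d j a).toReal :=
    fun t j a => M.marginal_toPolicy_succ s d t j a
  have hpow : ∀ t, p t = Matrix.vecMul (p 0) (M.chain d ^ t) := by
    intro t
    induction t with
    | zero => simp
    | succ t ih =>
      rw [pow_succ, ← Matrix.vecMul_vecMul, ← ih]
      ext j
      exact M.sum_mul_transition_eq_vecMul (hsucc t) j
  have hsum : ∑ j, p 0 j = 1 := by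
    rw [hp]
    simp only
    rw [sum_comm]
    simp_rw [← mul_sum, PMF.sum_toReal, mul_one]
    exact M.sum_marginal s d.toPolicy 0
  refine (tendsto_add_atTop_iff_nat 1).1 ?_
  refine ((FiniteChain.tendsto_vecMul_pow hν hsum j).mul_const _).congr fun t => ?_
  rw [hsucc, hpow t]

theorem exists_isSteadyState [DecidableEq S] [Nonempty S] (d : M.StationaryPolicy)
    (hu : FiniteChain.IsUnichain (M.chain d)) (ha : FiniteChain.IsAperiodic (M.chain d)) :
    ∃ π : PMF M.K, M.IsStationaryDistribution d π ∧ M.IsSteadyState d π := by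
  have hQ := M.chain_mem_rowStochastic d
  obtain ⟨ν, hν⟩ := FiniteChain.exists_tendsto_pow_apply hQ hu ha
  obtain ⟨i₀⟩ := ‹Nonempty S›
  have hν0 : ∀ j, 0 ≤ ν j := fun j =>
    ge_of_tendsto' (hν i₀ j) fun n => FiniteChain.pow_nonneg_apply hQ n i₀ j
  have hν1 : ∑ j, ν j = 1 := by
    refine tendsto_nhds_unique (tendsto_finsetSum univ fun j _ => hν i₀ j) ?_
    simp_rw [FiniteChain.sum_pow_apply hQ]
    exact tendsto_const_nhds
  have hw0 : ∀ k : M.K, 0 ≤ ν k.1 * (d k.1 k.2).toReal := fun k =>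
    mul_nonneg (hν0 _) ENNReal.toReal_nonneg
  have hw1 : ∑ k : M.K, ν k.1 * (d k.1 k.2).toReal = 1 := by
    rw [sum_pair]
    simp_rw [← mul_sum, PMF.sum_toReal, mul_one, hν1]
  let π : PMF M.K := PMF.ofFintype (fun k => ENNReal.ofReal (ν k.1 * (d k.1 k.2).toReal)) (by
    rw [← ENNReal.ofReal_sum_of_nonneg fun k _ => hw0 k, hw1, ENNReal.ofReal_one])
  have hπ : ∀ k, (π k).toReal = ν k.1 * (d k.1 k.2).toReal := fun k =>
    ENNReal.toReal_ofReal (hw0 k)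
  have hinv : Matrix.vecMul ν (M.chain d) = ν := by
    ext j
    refine tendsto_nhds_unique ?_ ((tendsto_add_atTop_iff_nat 1).2 (hν i₀ j))
    simp_rw [pow_succ, Matrix.mul_apply]
    exact tendsto_finsetSum univ fun i _ => (hν i₀ i).mul_const _
  refine ⟨π, ?_, fun s k => ?_⟩
  · refine PMF.ext fun ⟨j, a⟩ => ?_
    rw [← ENNReal.toReal_eq_toReal_iff' (PMF.apply_ne_top _ _) (PMF.apply_ne_top _ _), hπ,
      PMF.bind_apply, tsum_fintype,
      ENNReal.toReal_sum fun k _ => ENNReal.mul_ne_top (PMF.apply_ne_top _ _)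
        (PMF.apply_ne_top _ _)]
    -- The inner law is `stepLaw` of `d` after a history consisting of `k` alone.
    have h : ∀ k : M.K, ((M.P k).bind fun s' => (d s').map fun a => (⟨s', a⟩ : M.K)) ⟨j, a⟩
        = M.P k j * d j a := fun k => M.stepLaw_apply d.toPolicy 0 (fun _ => k) j a
    simp_rw [h, ENNReal.toReal_mul, ← mul_assoc]
    rw [← sum_mul, M.sum_mul_transition_eq_vecMul (fun i a => hπ ⟨i, a⟩), hinv]
  · rw [hπ]
    exact M.tendsto_marginal hν s k.1 k.2

/-- The state-action frequencies that satisfy the balance equations. -/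
def balancedFrequencies : Set (M.K → ℝ) :=
  {w | w ∈ stdSimplex ℝ M.K ∧ ∀ j, ∑ a, w ⟨j, a⟩ = ∑ k, w k * (M.P k j).toReal}

theorem isCompact_balancedFrequencies : IsCompact M.balancedFrequencies := by
  have h : IsClosed {w : M.K → ℝ | ∀ j, ∑ a, w ⟨j, a⟩ = ∑ k, w k * (M.P k j).toReal} := by
    rw [Set.ofPred_forall]
    exact isClosed_iInter fun j => isClosed_eq (by fun_prop) (by fun_prop)
  exact (isCompact_stdSimplex ℝ M.K).inter_right h

theorem toReal_mem_stdSimplex {β : Type*} [Fintype β] (π : PMF β) :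
    (fun b => (π b).toReal) ∈ stdSimplex ℝ β :=
  ⟨fun _ => ENNReal.toReal_nonneg, PMF.sum_toReal π⟩

theorem marginal_mem_stdSimplex (s : S) (u : M.Policy) (t : ℕ) :
    M.marginal s u t ∈ stdSimplex ℝ M.K :=
  ⟨M.marginal_nonneg s u t, M.sum_marginal s u t⟩

variable {M} in
theorem IsSteadyState.mem_balancedFrequencies [Nonempty S] {d : M.StationaryPolicy}
    {π : PMF M.K} (h : M.IsSteadyState d π) :
    (fun k => (π k).toReal) ∈ M.balancedFrequencies := by
  refine ⟨toReal_mem_stdSimplex π, fun j => ?_⟩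
  obtain ⟨s⟩ := ‹Nonempty S›
  refine tendsto_nhds_unique (f := fun t => ∑ a, M.marginal s d.toPolicy (t + 1) ⟨j, a⟩)
    (tendsto_finsetSum univ fun a _ => (tendsto_add_atTop_iff_nat 1).2 (h s ⟨j, a⟩)) ?_
  simp_rw [sum_marginal_succ]
  exact tendsto_finsetSum univ fun k _ => (h s k).mul_const _

/-- Balanced state-action frequencies are the steady state of some stationary policy. -/
theorem exists_policy_of_mem_balancedFrequencies [DecidableEq S] [Nonempty S]
    (hM : ∀ d : M.StationaryPolicy,
      FiniteChain.IsUnichain (M.chain d) ∧ FiniteChain.IsAperiodic (M.chain d))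
    {w : M.K → ℝ} (hw : w ∈ M.balancedFrequencies) :
    ∃ d : M.StationaryPolicy, ∀ π : PMF M.K, M.IsSteadyState d π → (fun k => (π k).toReal) = w := by
  obtain ⟨d, hd⟩ := M.exists_policy_of_nonneg hw.1.1
  refine ⟨d, fun π hπ => ?_⟩
  obtain ⟨ν, hν⟩ :=
    FiniteChain.exists_tendsto_pow_apply (M.chain_mem_rowStochastic d) (hM d).1 (hM d).2
  obtain ⟨s⟩ := ‹Nonempty S›
  set p : S → ℝ := fun i => ∑ b, w ⟨i, b⟩ with hp
  have hinv : Matrix.vecMul p (M.chain d) = p := by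
    ext j
    rw [← M.sum_mul_transition_eq_vecMul hd j, ← hw.2 j]
  have hpow : ∀ n, Matrix.vecMul p (M.chain d ^ n) = p := by
    intro n
    induction n with
    | zero => simp
    | succ n ih => rw [pow_succ', ← Matrix.vecMul_vecMul, hinv, ih]
  have hsum : ∑ i, p i = 1 := by rw [hp, ← sum_pair, hw.1.2]
  -- The invariant `p` is fixed by all powers, while those powers carry it to `ν`.
  have hpν : p = ν := by
    ext j
    have := FiniteChain.tendsto_vecMul_pow hν hsum j
    simp_rw [hpow] at this
    exact tendsto_nhds_unique tendsto_const_nhds this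
  ext ⟨j, a⟩
  rw [hd j a]
  change _ = p j * _
  rw [hpν]
  exact tendsto_nhds_unique (hπ s ⟨j, a⟩) (M.tendsto_marginal hν s j a)

theorem CVaR_toMeasure_eq {α : ℝ} (hα0 : 0 < α) (hα1 : α < 1) [Nonempty M.K] (π : PMF M.K) :
    CVaR α π.toMeasure M.r = cvarOfWeights α M.r fun k => (π k).toReal := by
  have := PMF.toMeasure.isProbabilityMeasure π
  rw [CVaR_eq_cvarOfWeights _ hα0 hα1]
  simp_rw [measureReal_def, PMF.toMeasure_apply_singleton _ _ (measurableSet_singleton _)]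

/-! ### Long-run averages and the upper bound for all policies -/

section Average

variable (s : S) (u : M.Policy)

/-- The expected state-action frequencies up to time `T`. -/
noncomputable def frequencies (T : ℕ) (k : M.K) : ℝ :=
  1 / (T : ℝ) * ∑ t ∈ range T, M.marginal s u t k

theorem frequencies_mem_stdSimplex {T : ℕ} (hT : T ≠ 0) :
    M.frequencies s u T ∈ stdSimplex ℝ M.K := by
  have hT' : (T : ℝ) ≠ 0 := by exact_mod_cast hT
  refine ⟨fun k => mul_nonneg (by positivity) (sum_nonneg fun t _ => M.marginal_nonneg s u t k), ?_⟩
  simp_rw [frequencies]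
  rw [← mul_sum, sum_comm]
  simp_rw [sum_marginal]
  simp [hT']

/-- The state-action frequencies satisfy the balance equations asymptotically. -/
theorem tendsto_frequencies_balance (j : S) :
    Tendsto (fun T => ∑ a, M.frequencies s u T ⟨j, a⟩
      - ∑ k, M.frequencies s u T k * (M.P k j).toReal) atTop (𝓝 0) := by
  set q : ℕ → ℝ := fun t => ∑ a, M.marginal s u t ⟨j, a⟩ with hq
  have hq0 : ∀ t, 0 ≤ q t := fun t => sum_nonneg fun a _ => M.marginal_nonneg s u t _
  have hq1 : ∀ t, q t ≤ 1 := fun t => by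
    rw [← M.sum_marginal s u t, sum_pair]
    exact single_le_sum (f := fun i => ∑ a, M.marginal s u t ⟨i, a⟩)
      (fun i _ => sum_nonneg fun a _ => M.marginal_nonneg s u t _) (mem_univ j)
  have heq : ∀ T : ℕ, ∑ a, M.frequencies s u T ⟨j, a⟩
      - ∑ k, M.frequencies s u T k * (M.P k j).toReal = 1 / (T : ℝ) * (q 0 - q T) := by
    intro T
    -- By the flow equation the inflow at time `t` is `q (t + 1)`, so the defect telescopes.
    rw [← sum_range_sub', mul_sum]
    simp_rw [frequencies, mul_assoc, sum_mul]
    rw [← mul_sum, ← mul_sum, sum_comm, sum_comm (t := range T), ← mul_sub, ← sum_sub_distrib,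
      mul_sum]
    refine sum_congr rfl fun t _ => ?_
    rw [hq]
    simp only
    rw [sum_marginal_succ]
  simp_rw [heq]
  refine squeeze_zero_norm (fun T => ?_) tendsto_one_div_atTop_nhds_zero_nat
  rw [norm_mul, Real.norm_of_nonneg (by positivity)]
  refine mul_le_of_le_one_right (by positivity) ?_
  rw [Real.norm_eq_abs, abs_le]
  constructor <;> linarith [hq0 0, hq1 0, hq0 T, hq1 T]

variable {α : ℝ} (hα0 : 0 < α) (hα1 : α < 1) [Nonempty M.K]
include hα0 hα1

theorem avgCVaR_le_cvarOfWeights {T : ℕ} (hT : T ≠ 0) :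
    M.avgCVaR α s u T ≤ cvarOfWeights α M.r (M.frequencies s u T) := by
  simp_rw [avgCVaR, M.rewardCVaR_eq s u hα0 hα1]
  exact average_cvarOfWeights_le α M.r _ hT

/-- Asymptotically no policy beats the best balanced state-action frequencies. -/
theorem eventually_avgCVaR_le {V : ℝ}
    (hV : ∀ w ∈ M.balancedFrequencies, cvarOfWeights α M.r w ≤ V) {ε : ℝ} (hε : 0 < ε) :
    ∀ᶠ T in atTop, M.avgCVaR α s u T ≤ V + ε := by
  by_contra hcon
  -- Along times violating the bound, the frequencies have a convergent subsequence; its limit is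
  -- balanced yet has value at least `V + ε`.
  obtain ⟨φ, hφ, hφV⟩ := extraction_of_frequently_atTop
    ((not_eventually.1 hcon).and_eventually (eventually_ne_atTop 0))
  obtain ⟨w, hw, ψ, hψ, hlim⟩ := (isCompact_stdSimplex ℝ M.K).tendsto_subseq
    fun n => M.frequencies_mem_stdSimplex s u (hφV n).2
  have htop : Tendsto (fun n => φ (ψ n)) atTop atTop := hφ.tendsto_atTop.comp hψ.tendsto_atTop
  have hbal : w ∈ M.balancedFrequencies := by
    refine ⟨hw, fun j => sub_eq_zero.1 ?_⟩
    have hc : Continuous fun w : M.K → ℝ =>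
        ∑ a, w ⟨j, a⟩ - ∑ k, w k * (M.P k j).toReal := by fun_prop
    exact tendsto_nhds_unique ((hc.tendsto w).comp hlim)
      ((M.tendsto_frequencies_balance s u j).comp htop)
  have hle : V + ε ≤ cvarOfWeights α M.r w :=
    ge_of_tendsto' (((continuous_cvarOfWeights α M.r).tendsto w).comp hlim) fun n =>
      (not_le.1 (hφV (ψ n)).1).le.trans
        (M.avgCVaR_le_cvarOfWeights s u hα0 hα1 (hφV (ψ n)).2)
  linarith [hV w hbal]

theorem exists_abs_avgCVaR_le : ∃ C, ∀ T, |M.avgCVaR α s u T| ≤ C := by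
  obtain ⟨C, hC⟩ := (isCompact_stdSimplex ℝ M.K).exists_bound_of_continuousOn
    (continuous_cvarOfWeights α M.r).continuousOn
  have hC0 : 0 ≤ C := (norm_nonneg _).trans (hC _ (M.marginal_mem_stdSimplex s u 0))
  refine ⟨C, fun T => ?_⟩
  simp_rw [avgCVaR, M.rewardCVaR_eq s u hα0 hα1]
  rw [abs_mul, abs_of_nonneg (by positivity)]
  calc 1 / (T : ℝ) * |∑ t ∈ range T, cvarOfWeights α M.r (M.marginal s u t)|
      ≤ 1 / (T : ℝ) * ∑ t ∈ range T, C := by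
        gcongr
        exact (abs_sum_le_sum_abs _ _).trans
          (sum_le_sum fun t _ => hC _ (M.marginal_mem_stdSimplex s u t))
    _ ≤ C := by
        rw [sum_const, card_range, nsmul_eq_mul, ← mul_assoc]
        -- This covers `T = 0` too, where `T⁻¹ * T = 0`.
        exact mul_le_of_le_one_left hC0 (by rw [one_div]; exact inv_mul_le_one)

theorem isBoundedUnder_le_avgCVaR : IsBoundedUnder (· ≤ ·) atTop (M.avgCVaR α s u) := by
  obtain ⟨C, hC⟩ := M.exists_abs_avgCVaR_le s u hα0 hα1
  exact isBoundedUnder_of ⟨C, fun T => (abs_le.1 (hC T)).2⟩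

theorem isBoundedUnder_ge_avgCVaR : IsBoundedUnder (· ≥ ·) atTop (M.avgCVaR α s u) := by
  obtain ⟨C, hC⟩ := M.exists_abs_avgCVaR_le s u hα0 hα1
  exact isBoundedUnder_of ⟨-C, fun T => (abs_le.1 (hC T)).1⟩

theorem limsupCVaR_le {V : ℝ}
    (hV : ∀ w ∈ M.balancedFrequencies, cvarOfWeights α M.r w ≤ V) : M.limsupCVaR α s u ≤ V :=
  le_of_forall_pos_le_add fun _ hε =>
    limsup_le_of_le (M.isBoundedUnder_ge_avgCVaR s u hα0 hα1).isCoboundedUnder_le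
      (M.eventually_avgCVaR_le s u hα0 hα1 hV hε)

theorem liminfCVaR_le_limsupCVaR : M.liminfCVaR α s u ≤ M.limsupCVaR α s u :=
  liminf_le_limsup (M.isBoundedUnder_le_avgCVaR s u hα0 hα1)
    (M.isBoundedUnder_ge_avgCVaR s u hα0 hα1)

theorem longRunCVaR_eq_limsupCVaR (hu : u ∈ M.convergentPolicies α) :
    M.longRunCVaR α s u = M.limsupCVaR α s u :=
  (tendsto_of_liminf_eq_limsup (hu s).symm rfl (M.isBoundedUnder_le_avgCVaR s u hα0 hα1)
    (M.isBoundedUnder_ge_avgCVaR s u hα0 hα1)).limUnder_eq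

variable {M} in
theorem IsSteadyState.tendsto_avgCVaR {d : M.StationaryPolicy} {π : PMF M.K}
    (h : M.IsSteadyState d π) :
    Tendsto (M.avgCVaR α s d.toPolicy) atTop (𝓝 (CVaR α π.toMeasure M.r)) := by
  have hlim : Tendsto (M.marginal s d.toPolicy) atTop (𝓝 fun k => (π k).toReal) :=
    tendsto_pi_nhds.2 (h s)
  have hF := ((continuous_cvarOfWeights α M.r).tendsto _).comp hlim
  rw [M.CVaR_toMeasure_eq hα0 hα1]
  refine hF.cesaro.congr fun T => ?_
  simp_rw [avgCVaR, M.rewardCVaR_eq s d.toPolicy hα0 hα1, one_div]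
  rfl

end Average

end MDP

/-! ### The main theorem -/

theorem theorem1 {S A : Type*} [Fintype S] [DecidableEq S] [Fintype A] (M : MDP S A)
    (hM : ∀ d : M.StationaryPolicy,
      FiniteChain.IsUnichain (M.chain d) ∧ FiniteChain.IsAperiodic (M.chain d))
    (α : ℝ) (hα0 : 0 < α) (hα1 : α < 1) :
    -- every stationary policy `d` has a steady-state distribution `π d`
    ∃ π : M.StationaryPolicy → PMF M.K,
      (∀ d, M.IsStationaryDistribution d (π d) ∧ M.IsSteadyState d (π d)) ∧
      -- `CVaR_α(R^d)` attains its maximum over the stationary policies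
      (∃ dstar : M.StationaryPolicy,
        ∀ d, CVaR α (π d).toMeasure M.r ≤ CVaR α (π dstar).toMeasure M.r) ∧
      -- and every maximizer attains the three optima, which are equal
      ∀ dstar : M.StationaryPolicy,
        (∀ d, CVaR α (π d).toMeasure M.r ≤ CVaR α (π dstar).toMeasure M.r) →
          dstar.toPolicy ∈ M.convergentPolicies α ∧
          ∀ s : S,
            Tendsto (M.avgCVaR α s dstar.toPolicy) atTop (𝓝 (CVaR α (π dstar).toMeasure M.r)) ∧
            M.limsupCVaR α s dstar.toPolicy = CVaR α (π dstar).toMeasure M.r ∧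
            M.liminfCVaR α s dstar.toPolicy = CVaR α (π dstar).toMeasure M.r ∧
            M.longRunCVaR α s dstar.toPolicy = CVaR α (π dstar).toMeasure M.r ∧
            IsLUB (Set.range fun u : M.Policy => M.limsupCVaR α s u)
              (CVaR α (π dstar).toMeasure M.r) ∧
            IsLUB (Set.range fun u : M.Policy => M.liminfCVaR α s u)
              (CVaR α (π dstar).toMeasure M.r) ∧
            IsLUB ((fun u : M.Policy => M.longRunCVaR α s u) '' M.convergentPolicies α)
              (CVaR α (π dstar).toMeasure M.r) := by
  -- A policy exists even for empty `S`; the recurrent class of its chain then supplies a state.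
  have hne : Nonempty S := by
    have d : M.StationaryPolicy := fun s =>
      PMF.pure ⟨(M.actions_nonempty s).choose, (M.actions_nonempty s).choose_spec⟩
    obtain ⟨C, hC, -⟩ := (hM d).1
    exact ⟨hC.1.choose⟩
  have hneK : Nonempty M.K := by
    obtain ⟨s⟩ := hne
    obtain ⟨a, ha⟩ := M.actions_nonempty s
    exact ⟨⟨s, a, ha⟩⟩
  choose π hπ using fun d => M.exists_isSteadyState d (hM d).1 (hM d).2
  have hmem : ∀ d, (fun k => (π d k).toReal) ∈ M.balancedFrequencies := fun d =>
    (hπ d).2.mem_balancedFrequencies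
  have hrepr : ∀ w ∈ M.balancedFrequencies, ∃ d, (fun k => (π d k).toReal) = w := fun w hw => by
    obtain ⟨d, hd⟩ := M.exists_policy_of_mem_balancedFrequencies hM hw
    exact ⟨d, hd (π d) (hπ d).2⟩
  refine ⟨π, hπ, ?_, fun dstar hmax => ?_⟩
  · obtain ⟨s⟩ := hne
    have d₀ : M.StationaryPolicy := fun s =>
      PMF.pure ⟨(M.actions_nonempty s).choose, (M.actions_nonempty s).choose_spec⟩
    obtain ⟨w, hw, hwmax⟩ := M.isCompact_balancedFrequencies.exists_isMaxOn ⟨_, hmem d₀⟩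
      (continuous_cvarOfWeights α M.r).continuousOn
    obtain ⟨dstar, hd⟩ := hrepr w hw
    refine ⟨dstar, fun d => ?_⟩
    rw [M.CVaR_toMeasure_eq hα0 hα1, M.CVaR_toMeasure_eq hα0 hα1, hd]
    exact hwmax (hmem d)
  · set V := CVaR α (π dstar).toMeasure M.r with hVdef
    -- Optimality among stationary policies is optimality over all balanced laws, since each of
    -- these is some `π d`.
    have hV : ∀ w ∈ M.balancedFrequencies, cvarOfWeights α M.r w ≤ V := fun w hw => by
      obtain ⟨d, rfl⟩ := hrepr w hw
      rw [← M.CVaR_toMeasure_eq hα0 hα1]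
      exact hmax d
    have hlim : ∀ s, Tendsto (M.avgCVaR α s dstar.toPolicy) atTop (𝓝 V) := fun s =>
      (hπ dstar).2.tendsto_avgCVaR s hα0 hα1
    have hsup : ∀ s, M.limsupCVaR α s dstar.toPolicy = V := fun s => (hlim s).limsup_eq
    have hinf : ∀ s, M.liminfCVaR α s dstar.toPolicy = V := fun s => (hlim s).liminf_eq
    have hrun : ∀ s, M.longRunCVaR α s dstar.toPolicy = V := fun s => (hlim s).limUnder_eq
    have hconv : dstar.toPolicy ∈ M.convergentPolicies α := fun s => by rw [hsup, hinf]
    have hle : ∀ s u, M.limsupCVaR α s u ≤ V := fun s u => M.limsupCVaR_le s u hα0 hα1 hV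
    refine ⟨hconv, fun s => ⟨hlim s, hsup s, hinf s, hrun s, ?_, ?_, ?_⟩⟩
    · refine IsGreatest.isLUB ⟨⟨_, hsup s⟩, ?_⟩
      rintro _ ⟨u, rfl⟩
      exact hle s u
    · refine IsGreatest.isLUB ⟨⟨_, hinf s⟩, ?_⟩
      rintro _ ⟨u, rfl⟩
      exact (M.liminfCVaR_le_limsupCVaR s u hα0 hα1).trans (hle s u)
    · refine IsGreatest.isLUB ⟨⟨_, hconv, hrun s⟩, ?_⟩
      rintro _ ⟨u, hu, rfl⟩
      exact (M.longRunCVaR_eq_limsupCVaR s u hα0 hα1 hu).le.trans (hle s u)
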